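/- Let $n\ge 1$ and let $U\subset\mathbb R^n$ be a bounded domain (non-empty, open, connected) whose boundary $S$ consists of finitely many disjoint closed smooth hypersurfaces. Let $A=\sum_{|\alpha|\le m}a_\alpha(x)\partial^\alpha$ be an elliptic differential operator on $U$ of even order $m\ge 2$ with real coefficients continuous on $\bar U$, and let $B_1,\dots,B_{m/2}$ be differential boundary operators with real coefficients continuous on $S$, such that the normal direction is not characteristic for any $B_j$ at any point of $S$, and such that the orders $m_j$ of the $B_j$ are less than $m$ and pairwise distinct. Work in the real spaces $L^2(U)$ and $H^m(U)$ and put $$\mathcal D(A)=\{u\in H^m(U): B_ju=0 \text{ on } S \text{ (in the sense of traces)},\ j=1,\dots,m/2\}.$$ Assume that $(U,A,B_1,\dots,B_{m/2})$ is admissible, that is, that moreover $A$ maps $\mathcal D(A)$ one-to-one onto $L^2(U)$ and that the Green's operator $A^{-1}:L^2(U)\to L^2(U)$ is self-adjoint. Assume that $A$ is positive, that is, that all eigenvalues of $A^{-1}$ are real and positive, and that $m>n/2$. A Green's function of the collection is a function $G\in L^2(U\times U)$ such that, for every $f\in L^2(U)$, $$(A^{-1}f)(x)=\int_U G(x,\xi)f(\xi)\,d\xi\quad\text{for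 almost every }x\in U .$$ Then a Green's function exists, and every Green's function $G$ is integrable on $U\times U$ and satisfies $$\int_U\int_U G(x,\xi)\,d\xi\,dx\ \ge\ 0 .$$ Equivalently, the boundary value problem $Au=1$ has exactly one solution $u\in\mathcal D(A)$, its mean value satisfies $\frac1{|U|}\int_U u\,dx\ge 0$, and $\int_U\int_U G(x,\xi)\,d\xi\,dx=\int_U u\,dx$ for every Green's function $G$. -/

import Mathlib

open MeasureTheory Filter Topology Set
open scoped ContDiff ENNReal

noncomputable section

namespace BVP

/-- Euclidean space `ℝⁿ`. -/
abbrev E (n : ℕ) := EuclideanSpace ℝ (Fin n)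

/-- The real Hilbert space `L²(U)`. -/
abbrev L2 {n : ℕ} (U : Set (E n)) := Lp ℝ 2 (volume.restrict U)

/-! ### Multi-indices and weak derivatives -/

/-- The multi-indices `α` with `|α| ≤ k`. -/
def multiIndices (n k : ℕ) : Finset (Fin n → ℕ) :=
  (Finset.range (k + 1)).biUnion fun j => Finset.piAntidiag Finset.univ j

/-- The order `|α|` of a multi-index. -/
def absIndex {n : ℕ} (α : Fin n → ℕ) : ℕ := ∑ i, α i

theorem mem_multiIndices {n k : ℕ} {α : Fin n → ℕ} :
    α ∈ multiIndices n k ↔ absIndex α ≤ k := by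
  simp [multiIndices, absIndex]

/-- The classical partial derivative `∂f/∂xᵢ`. -/
def pderiv {n : ℕ} (i : Fin n) (f : E n → ℝ) : E n → ℝ :=
  fun x => fderiv ℝ f x (EuclideanSpace.single i 1)

/-- The classical partial derivative `∂^α f = ∂₁^{α₁} ⋯ ∂ₙ^{αₙ} f`. -/
def partialDeriv {n : ℕ} (α : Fin n → ℕ) (f : E n → ℝ) : E n → ℝ :=
  (List.finRange n).foldr (fun i g => (pderiv i)^[α i] g) f

/-- `v ∈ L²(U)` is the weak derivative `D^α u` of `u ∈ L²(U)` in the open set `U`. -/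
def HasWeakDeriv {n : ℕ} (U : Set (E n)) (α : Fin n → ℕ) (u v : L2 U) : Prop :=
  ∀ φ : E n → ℝ, ContDiff ℝ ∞ φ → HasCompactSupport φ → tsupport φ ⊆ U →
    ∫ x in U, u x * partialDeriv α φ x = (-1) ^ absIndex α * ∫ x in U, v x * φ x

/-- `u ∈ H^m(U)`: all weak derivatives of order at most `m` exist in `L²(U)`. -/
def MemH {n : ℕ} (U : Set (E n)) (m : ℕ) (u : L2 U) : Prop :=
  ∀ α : Fin n → ℕ, absIndex α ≤ m → ∃ v : L2 U, HasWeakDeriv U α u v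

open Classical in
/-- The weak derivative `D^α u ∈ L²(U)` (zero if there is none). -/
def weakDeriv {n : ℕ} (U : Set (E n)) (α : Fin n → ℕ) (u : L2 U) : L2 U :=
  if h : ∃ v : L2 U, HasWeakDeriv U α u v then h.choose else 0

/-! ### Smooth boundaries and traces -/

/-- `ρ` is a smooth local defining function of `U` on the open neighbourhood `V` of the
boundary point `x`. -/
structure IsLocalDefiningFunction {n : ℕ} (U : Set (E n)) (x : E n) (V : Set (E n))
    (ρ : E n → ℝ) : Prop where
  isOpen : IsOpen V
  mem : x ∈ V
  contDiffOn : ContDiffOn ℝ ∞ ρ V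
  gradient_ne_zero : gradient ρ x ≠ 0
  mem_iff : ∀ y ∈ V, y ∈ U ↔ ρ y < 0

/-- The boundary of `U` is a smooth hypersurface with `U` locally on one side. For bounded `U` it
is compact, so it consists of finitely many connected smooth hypersurfaces. -/
def HasSmoothBoundary {n : ℕ} (U : Set (E n)) : Prop :=
  ∀ x ∈ frontier U, ∃ V ρ, IsLocalDefiningFunction U x V ρ

/-- `ν` is a non-zero (outer) normal vector of the boundary of `U` at `x`; its length is not
normalized. -/
def IsNormalAt {n : ℕ} (U : Set (E n)) (x ν : E n) : Prop :=
  ∃ V ρ, IsLocalDefiningFunction U x V ρ ∧ ν = gradient ρ x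

/-- Surface measure on the boundary of `U` (up to a positive constant factor). -/
def surfaceMeasure {n : ℕ} (U : Set (E n)) : Measure (E n) :=
  (Measure.hausdorffMeasure ((n : ℝ) - 1)).restrict (frontier U)

/-- `g ∈ L²(∂U)` is the trace of `v ∈ H¹(U)`: there are functions, smooth up to the boundary,
that converge to `v` in `H¹(U)` and whose boundary values converge to `g` in `L²(∂U)`. -/
def HasTrace {n : ℕ} (U : Set (E n)) (v : L2 U) (g : E n → ℝ) : Prop :=
  MemH U 1 v ∧ MemLp g 2 (surfaceMeasure U) ∧
  ∃ φ : ℕ → E n → ℝ, (∀ k, ContDiff ℝ ∞ (φ k)) ∧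
    Tendsto (fun k => eLpNorm (fun x => φ k x - v x) 2 (volume.restrict U)) atTop (𝓝 0) ∧
    (∀ i : Fin n, Tendsto (fun k => eLpNorm
      (fun x => pderiv i (φ k) x - weakDeriv U (Pi.single i 1) v x) 2 (volume.restrict U))
      atTop (𝓝 0)) ∧
    Tendsto (fun k => eLpNorm (fun x => φ k x - g x) 2 (surfaceMeasure U)) atTop (𝓝 0)

/-! ### Differential operators -/

/-- A linear differential expression `∑_{|α| ≤ order} c_α(x) ∂^α`; coefficients `c_α` with
`|α| > order` play no role. -/
structure DiffOp (n : ℕ) where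
  order : ℕ
  coeff : (Fin n → ℕ) → E n → ℝ

/-- The principal symbol `∑_{|α| = order} c_α(x) ξ^α`. -/
def DiffOp.symbol {n : ℕ} (P : DiffOp n) (x ξ : E n) : ℝ :=
  ∑ α ∈ Finset.piAntidiag Finset.univ P.order, P.coeff α x * ∏ i, ξ i ^ α i

/-- The function `∑_{|α| ≤ order} c_α D^α u` on `U`, with weak derivatives. -/
def DiffOp.expr {n : ℕ} (P : DiffOp n) (U : Set (E n)) (u : L2 U) : E n → ℝ :=
  fun x => ∑ α ∈ multiIndices n P.order, P.coeff α x * weakDeriv U α u x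

open Classical in
/-- `u ↦ P u` as a map into `L²(U)` (zero if `P u` is not square integrable, which cannot happen
for `u ∈ H^order(U)`, `U` bounded and coefficients continuous on the closure of `U`). -/
def DiffOp.toL2 {n : ℕ} (P : DiffOp n) (U : Set (E n)) (u : L2 U) : L2 U :=
  if h : MemLp (P.expr U u) 2 (volume.restrict U) then h.toLp else 0

/-- `P u = 0` on the boundary of `U`, in the sense of traces of the derivatives of `u`. -/
def DiffOp.VanishesOnBoundary {n : ℕ} (P : DiffOp n) (U : Set (E n)) (u : L2 U) : Prop :=
  ∃ g : (Fin n → ℕ) → E n → ℝ,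
    (∀ α, absIndex α ≤ P.order → HasTrace U (weakDeriv U α u) (g α)) ∧
    ∀ᵐ x ∂(surfaceMeasure U), ∑ α ∈ multiIndices n P.order, P.coeff α x * g α x = 0

/-! ### Admissible collections and Green's functions -/

/-- An ordered collection `(U, A, B₁, …, B_{m/2})`, where `m` is the order of `A`. -/
structure Collection (n : ℕ) where
  U : Set (E n)
  A : DiffOp n
  B : Fin (A.order / 2) → DiffOp n

variable {n : ℕ}

/-- The domain `𝒟(A)`: all `u ∈ H^m(U)` with `B_j u = 0` on the boundary for all `j`. -/
def Collection.domain (C : Collection n) : Set (L2 C.U) :=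
  {u | MemH C.U C.A.order u ∧ ∀ j, (C.B j).VanishesOnBoundary C.U u}

/-- The Green's operator `G = A⁻¹`, the inverse of `A : 𝒟(A) → L²(U)`. -/
def Collection.greenOperator (C : Collection n) : L2 C.U → L2 C.U :=
  Function.invFunOn (C.A.toL2 C.U) C.domain

/-- Admissible ordered collections. -/
structure Collection.IsAdmissible (C : Collection n) : Prop where
  isOpen : IsOpen C.U
  isConnected : IsConnected C.U
  isBounded : Bornology.IsBounded C.U
  smoothBoundary : HasSmoothBoundary C.U
  even_order : Even C.A.order
  order_pos : 0 < C.A.order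
  continuous_coeff : ∀ α, absIndex α ≤ C.A.order → ContinuousOn (C.A.coeff α) (closure C.U)
  elliptic : ∀ x ∈ C.U, ∀ ξ : E n, ξ ≠ 0 → C.A.symbol x ξ ≠ 0
  continuous_coeff_boundary : ∀ j α, absIndex α ≤ (C.B j).order →
    ContinuousOn ((C.B j).coeff α) (frontier C.U)
  noncharacteristic : ∀ j, ∀ x ∈ frontier C.U, ∀ ν, IsNormalAt C.U x ν → (C.B j).symbol x ν ≠ 0
  order_lt : ∀ j, (C.B j).order < C.A.order
  order_injective : Function.Injective fun j => (C.B j).order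
  bijOn : Set.BijOn (C.A.toL2 C.U) C.domain Set.univ
  selfAdjoint : ∃ T : L2 C.U →L[ℝ] L2 C.U, IsSelfAdjoint T ∧ ∀ f, T f = C.greenOperator f

/-- Positivity: all eigenvalues of the Green's operator are positive. (They are real, and
eigenvalues of the real operator, because the Green's operator is self-adjoint.) -/
def Collection.IsPositive (C : Collection n) : Prop :=
  ∀ (c : ℝ) (v : L2 C.U), v ≠ 0 → C.greenOperator v = c • v → 0 < c

/-- `K` is a Green's function: a square integrable kernel that represents the Green's operator. -/
structure Collection.IsGreenFunction (C : Collection n) (K : E n → E n → ℝ) : Prop where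
  memLp : MemLp (Function.uncurry K) 2 ((volume.restrict C.U).prod (volume.restrict C.U))
  represents : ∀ f : L2 C.U,
    C.greenOperator f =ᵐ[volume.restrict C.U] fun x => ∫ ξ in C.U, K x ξ * f ξ

end BVP

end

open MeasureTheory Filter Topology Set
open scoped ContDiff ENNReal

noncomputable section

namespace BVP

variable {n : ℕ}

/-! ### Calculus of test functions -/

/-! Write u = A⁻¹1. By the kernel representation, ∬ G = ∫ u = ⟨A⁻¹1, 1⟩, so everything reduces to
two facts about A⁻¹: it has an L² kernel, and its quadratic form is non-negative. Both follow once
A⁻¹ is known to be Hilbert–Schmidt. The kernel is then the sum of the tensors A⁻¹bᵢ ⊗ bᵢ over a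
Hilbert basis (`exists_kernel`). The operator is also compact
(`isCompactOperator_of_summable_norm_sq`), so the spectral theorem diagonalises it and positive
eigenvalues give a non-negative form (`inner_nonneg_of_eigenvalues_nonneg`).

The Hilbert–Schmidt property uses only that A⁻¹ is bounded and has its range in Hᵐ(U). Since m >
n/2, Hᵐ(U) lies in L^∞(U) (`MemH.exists_ae_abs_le`), and a bounded operator on L² of a finite
measure with range in L^∞ is Hilbert–Schmidt (`summable_norm_sq_apply`).

The Sobolev embedding is proved with averages of u over x + tK, where the cone over K with vertex x
stays in U. Their t-derivative is a sum of averages of the first weak derivatives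
(`hasDerivAt_mean`). Integrating in t, once per derivative, improves the Cauchy–Schwarz bound
t^(-n/2) to a constant, and letting t → 0 bounds u almost everywhere. -/

theorem contDiff_pderiv (i : Fin n) {f : E n → ℝ} (hf : ContDiff ℝ ∞ f) :
    ContDiff ℝ ∞ (pderiv i f) :=
  (hf.fderiv_right (m := ∞) (by simp)).clm_apply contDiff_const

theorem tsupport_pderiv_subset (i : Fin n) (f : E n → ℝ) : tsupport (pderiv i f) ⊆ tsupport f :=
  (closure_mono fun x hx => by
    rw [Function.mem_support] at hx ⊢
    intro h
    exact hx (by simp [pderiv, h])).trans (tsupport_fderiv_subset ℝ (f := f))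

theorem pderiv_comm (i j : Fin n) {f : E n → ℝ} (hf : ContDiff ℝ ∞ f) :
    pderiv i (pderiv j f) = pderiv j (pderiv i f) := by
  have key : ∀ (a b : Fin n) (x : E n), pderiv a (pderiv b f) x =
      fderiv ℝ (fderiv ℝ f) x (EuclideanSpace.single a 1) (EuclideanSpace.single b 1) := by
    intro a b x
    have h : DifferentiableAt ℝ (fderiv ℝ f) x :=
      ((hf.fderiv_right (m := ∞) (by simp)).differentiable (by simp)) x
    have := (h.hasFDerivAt.clm_apply (hasFDerivAt_const (EuclideanSpace.single b (1 : ℝ)) x)).fderiv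
    have hb : pderiv b f = fun y => fderiv ℝ f y (EuclideanSpace.single b 1) := rfl
    rw [pderiv, hb, this]
    simp
  ext x
  rw [key, key]
  have hs : IsSymmSndFDerivAt ℝ f x :=
    hf.contDiffAt.isSymmSndFDerivAt (by simpa using WithTop.coe_le_coe.2 (le_top : (2 : ℕ∞) ≤ ⊤))
  exact hs.eq _ _

theorem contDiff_iterate_pderiv (i : Fin n) (k : ℕ) {f : E n → ℝ} (hf : ContDiff ℝ ∞ f) :
    ContDiff ℝ ∞ ((pderiv i)^[k] f) := by
  induction k with
  | zero => exact hf
  | succ k ih => rw [Function.iterate_succ_apply']; exact contDiff_pderiv i ih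

theorem tsupport_iterate_pderiv_subset (i : Fin n) (k : ℕ) (f : E n → ℝ) :
    tsupport ((pderiv i)^[k] f) ⊆ tsupport f := by
  induction k with
  | zero => exact subset_rfl
  | succ k ih =>
    rw [Function.iterate_succ_apply']; exact (tsupport_pderiv_subset i _).trans ih

theorem pderiv_iterate_comm (i j : Fin n) (k : ℕ) {f : E n → ℝ} (hf : ContDiff ℝ ∞ f) :
    pderiv i ((pderiv j)^[k] f) = (pderiv j)^[k] (pderiv i f) := by
  induction k with
  | zero => rfl
  | succ k ih =>
    rw [Function.iterate_succ_apply', Function.iterate_succ_apply', ← ih,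
      pderiv_comm i j (contDiff_iterate_pderiv j k hf)]

/-- Iterated partial derivatives along the list `l` of coordinates. -/
def listDeriv (α : Fin n → ℕ) (l : List (Fin n)) (f : E n → ℝ) : E n → ℝ :=
  l.foldr (fun i g => (pderiv i)^[α i] g) f

theorem contDiff_listDeriv (α : Fin n → ℕ) (l : List (Fin n)) {f : E n → ℝ}
    (hf : ContDiff ℝ ∞ f) : ContDiff ℝ ∞ (listDeriv α l f) := by
  induction l with
  | nil => exact hf
  | cons j l ih => exact contDiff_iterate_pderiv j _ ih

theorem tsupport_listDeriv_subset (α : Fin n → ℕ) (l : List (Fin n)) (f : E n → ℝ) :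
    tsupport (listDeriv α l f) ⊆ tsupport f := by
  induction l with
  | nil => exact subset_rfl
  | cons j l ih => exact (tsupport_iterate_pderiv_subset j _ _).trans ih

theorem pderiv_listDeriv (i : Fin n) (α : Fin n → ℕ) (l : List (Fin n)) {f : E n → ℝ}
    (hf : ContDiff ℝ ∞ f) : pderiv i (listDeriv α l f) = listDeriv α l (pderiv i f) := by
  induction l with
  | nil => rfl
  | cons j l ih =>
    simp only [listDeriv, List.foldr_cons] at ih ⊢
    rw [← ih]
    exact pderiv_iterate_comm i j _ (contDiff_listDeriv α l hf)

/-- Without repetitions in `l`, the coordinate `i` is met at most once, so raising its exponent by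
one costs exactly one extra derivative, which commutes to the inside. -/
theorem listDeriv_add_single (i : Fin n) (α : Fin n → ℕ) (l : List (Fin n)) (hl : l.Nodup)
    {f : E n → ℝ} (hf : ContDiff ℝ ∞ f) :
    listDeriv (α + Pi.single i 1) l f =
      if i ∈ l then listDeriv α l (pderiv i f) else listDeriv α l f := by
  induction l with
  | nil => simp [listDeriv]
  | cons j l ih =>
    have ih := ih hl.of_cons
    have hj : j ∉ l := hl.notMem
    have hc : ∀ (β : Fin n → ℕ) g, listDeriv β (j :: l) g = (pderiv j)^[β j] (listDeriv β l g) :=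
      fun _ _ => rfl
    simp only [hc]
    by_cases hij : i = j
    · subst hij
      rw [ih]
      simp [hj, ← pderiv_listDeriv i α l hf]
    · rw [ih]
      have : (α + Pi.single i 1 : Fin n → ℕ) j = α j := by
        simp [Ne.symm hij]
      rw [this]
      by_cases hil : i ∈ l <;> simp [hil, hij]

theorem partialDeriv_add_single (i : Fin n) (α : Fin n → ℕ) {f : E n → ℝ}
    (hf : ContDiff ℝ ∞ f) :
    partialDeriv (α + Pi.single i 1) f = partialDeriv α (pderiv i f) := by
  have := listDeriv_add_single i α (List.finRange n) (List.nodup_finRange n) hf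
  rwa [if_pos (List.mem_finRange i)] at this

theorem pderiv_partialDeriv (i : Fin n) (α : Fin n → ℕ) {f : E n → ℝ} (hf : ContDiff ℝ ∞ f) :
    pderiv i (partialDeriv α f) = partialDeriv α (pderiv i f) :=
  pderiv_listDeriv i α _ hf

theorem contDiff_partialDeriv (α : Fin n → ℕ) {f : E n → ℝ} (hf : ContDiff ℝ ∞ f) :
    ContDiff ℝ ∞ (partialDeriv α f) :=
  contDiff_listDeriv α _ hf

theorem tsupport_partialDeriv_subset (α : Fin n → ℕ) (f : E n → ℝ) :
    tsupport (partialDeriv α f) ⊆ tsupport f :=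
  tsupport_listDeriv_subset α _ f

theorem partialDeriv_zero (f : E n → ℝ) : partialDeriv 0 f = f := by
  have : ∀ l : List (Fin n), listDeriv 0 l f = f := by
    intro l
    induction l with
    | nil => rfl
    | cons j l ih => exact ih
  exact this _

theorem partialDeriv_single (i : Fin n) {f : E n → ℝ} (hf : ContDiff ℝ ∞ f) :
    partialDeriv (Pi.single i 1) f = pderiv i f := by
  simpa [partialDeriv_zero] using partialDeriv_add_single i 0 hf

theorem absIndex_single (i : Fin n) : absIndex (Pi.single i 1) = 1 := by
  simp [absIndex]

/-! ### Weak derivatives -/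

theorem HasWeakDeriv.integral_mul_pderiv {U : Set (E n)} {i : Fin n} {u v : L2 U}
    (h : HasWeakDeriv U (Pi.single i 1) u v) {φ : E n → ℝ} (hφ : ContDiff ℝ ∞ φ)
    (hc : HasCompactSupport φ) (hs : tsupport φ ⊆ U) :
    ∫ x in U, u x * pderiv i φ x = -∫ x in U, v x * φ x := by
  have := h φ hφ hc hs
  rwa [partialDeriv_single i hφ, absIndex_single, pow_one, neg_one_mul] at this

/-- D^α of D_i u is D^(α + e_i) u: test the definition of D_i u with ∂^α φ. This drives the
inductions on the order. -/
theorem MemH.exists_weakDeriv {U : Set (E n)} {m : ℕ} {u : L2 U} (hu : MemH U (m + 1) u)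
    (i : Fin n) : ∃ v : L2 U, HasWeakDeriv U (Pi.single i 1) u v ∧ MemH U m v := by
  obtain ⟨v, hv⟩ := hu (Pi.single i 1) (by rw [absIndex_single]; omega)
  refine ⟨v, hv, fun α hα => ?_⟩
  have hadd : absIndex (α + Pi.single i 1) = absIndex α + 1 := by
    simp [absIndex, Finset.sum_add_distrib]
  obtain ⟨w, hw⟩ := hu (α + Pi.single i 1) (by omega)
  refine ⟨w, fun φ hφ hc hs => ?_⟩
  have h1 := hv.integral_mul_pderiv (contDiff_partialDeriv α hφ)
    (hc.of_isClosed_subset (isClosed_tsupport _) (tsupport_partialDeriv_subset α φ))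
    ((tsupport_partialDeriv_subset α φ).trans hs)
  have h2 := hw φ hφ hc hs
  rw [pderiv_partialDeriv i α hφ, ← partialDeriv_add_single i α hφ, h2, hadd, pow_succ] at h1
  linarith

/-! ### Averages over a shrinking family of sets -/

/-- The rescaled weight `y ↦ t⁻ⁿ φ((y - x) / t)`. -/
def rescale (φ : E n → ℝ) (x : E n) (t : ℝ) (y : E n) : ℝ := (t ^ n)⁻¹ * φ (t⁻¹ • (y - x))

/-- The weight `z ↦ zᵢ φ(z)`. -/
def coordMul (i : Fin n) (φ : E n → ℝ) : E n → ℝ := fun z => z i * φ z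

/-- The points `x` with `x + t K ⊆ U` for all `0 < t ≤ 1`. -/
def coneSet (U K : Set (E n)) : Set (E n) := {x | ∀ t ∈ Ioc (0 : ℝ) 1, ∀ z ∈ K, x + t • z ∈ U}

theorem contDiff_coordMul (i : Fin n) {φ : E n → ℝ} (hφ : ContDiff ℝ ∞ φ) :
    ContDiff ℝ ∞ (coordMul i φ) :=
  ContDiff.mul (by fun_prop) hφ

theorem tsupport_coordMul_subset (i : Fin n) (φ : E n → ℝ) :
    tsupport (coordMul i φ) ⊆ tsupport φ :=
  closure_mono fun x hx => by
    rw [Function.mem_support] at hx ⊢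
    exact right_ne_zero_of_mul hx

theorem contDiff_rescale {φ : E n → ℝ} (hφ : ContDiff ℝ ∞ φ) (x : E n) (t : ℝ) :
    ContDiff ℝ ∞ (rescale φ x t) := by
  unfold rescale
  exact contDiff_const.mul (hφ.comp (by fun_prop))

theorem tsupport_rescale_subset {φ : E n → ℝ} {K : Set (E n)} (hK : tsupport φ ⊆ K) (x : E n)
    {t : ℝ} (ht : t ≠ 0) : tsupport (rescale φ x t) ⊆ (fun z => x + t • z) '' K := by
  have h : tsupport (rescale φ x t) ⊆ (fun y => t⁻¹ • (y - x)) ⁻¹' tsupport φ := by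
    refine closure_minimal (fun y hy => ?_)
      ((isClosed_tsupport φ).preimage (by fun_prop))
    rw [Function.mem_support] at hy
    exact subset_tsupport _ (right_ne_zero_of_mul hy)
  refine h.trans fun y hy => ⟨t⁻¹ • (y - x), hK hy, ?_⟩
  simp [smul_smul, ht]

theorem hasCompactSupport_rescale {φ : E n → ℝ} {K : Set (E n)} (hcK : IsCompact K)
    (hK : tsupport φ ⊆ K) (x : E n) {t : ℝ} (ht : t ≠ 0) : HasCompactSupport (rescale φ x t) :=
  (hcK.image (by fun_prop)).of_isClosed_subset (isClosed_tsupport _)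
    (tsupport_rescale_subset hK x ht)

theorem tsupport_rescale_subset_of_mem {U : Set (E n)} {φ : E n → ℝ} {K : Set (E n)}
    (hK : tsupport φ ⊆ K) {x : E n} (hx : x ∈ coneSet U K) {t : ℝ} (ht : t ∈ Ioc (0 : ℝ) 1) :
    tsupport (rescale φ x t) ⊆ U := by
  refine (tsupport_rescale_subset hK x ht.1.ne').trans ?_
  rintro _ ⟨z, hz, rfl⟩
  exact hx t ht z hz

/-- The function `div (z φ(z))`. -/
def radialDiv (φ : E n → ℝ) (z : E n) : ℝ := n * φ z + fderiv ℝ φ z z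

theorem continuous_radialDiv {φ : E n → ℝ} (hφ : ContDiff ℝ ∞ φ) : Continuous (radialDiv φ) :=
  (continuous_const.mul hφ.continuous).add
    ((hφ.continuous_fderiv (by simp)).clm_apply continuous_id)

theorem hasCompactSupport_radialDiv {φ : E n → ℝ} (hc : HasCompactSupport φ) :
    HasCompactSupport (radialDiv φ) := by
  refine hc.mono' fun z hz => ?_
  by_contra h
  apply hz
  have h1 : φ z = 0 := image_eq_zero_of_notMem_tsupport h
  have h2 : fderiv ℝ φ z = 0 := by
    by_contra h'
    exact h (tsupport_fderiv_subset ℝ (subset_tsupport _ h'))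
  simp [radialDiv, h1, h2]

/-- Together with `hasDerivAt_rescale` this shows that the t-derivative of the rescaled weight is
minus a divergence in y, which can be integrated by parts against u. -/
theorem sum_pderiv_rescale_coordMul {φ : E n → ℝ} (hφ : ContDiff ℝ ∞ φ) (x : E n) (t : ℝ)
    (y : E n) : ∑ i, pderiv i (rescale (coordMul i φ) x t) y =
      (t ^ (n + 1))⁻¹ * radialDiv φ (t⁻¹ • (y - x)) := by
  set w := t⁻¹ • (y - x) with hw
  have hd : HasFDerivAt φ (fderiv ℝ φ w) w := (hφ.differentiable (by simp) w).hasFDerivAt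
  have hlin : HasFDerivAt (fun y : E n => t⁻¹ • (y - x))
      (t⁻¹ • ContinuousLinearMap.id ℝ (E n)) y := ((hasFDerivAt_id y).sub_const x).fun_const_smul _
  have h1 : ∀ i, pderiv i (rescale (coordMul i φ) x t) y =
      (t ^ (n + 1))⁻¹ * (φ w + fderiv ℝ φ w (w i • EuclideanSpace.single i 1)) := by
    intro i
    have hi : HasFDerivAt (fun z : E n => z i) (EuclideanSpace.proj i : E n →L[ℝ] ℝ) w :=
      (EuclideanSpace.proj i : E n →L[ℝ] ℝ).hasFDerivAt
    have := ((hi.mul hd).comp y hlin).const_mul (t ^ n)⁻¹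
    have h2 : fderiv ℝ (rescale (coordMul i φ) x t) y = _ := this.fderiv
    rw [pderiv, h2]
    simp [pow_succ]
    ring
  have hsum : ∑ i, w i • EuclideanSpace.single i (1 : ℝ) = w := by
    ext j
    simp [Pi.single_apply]
  simp_rw [h1]
  rw [← Finset.mul_sum, Finset.sum_add_distrib, ← map_sum, hsum]
  simp [radialDiv]

theorem hasDerivAt_rescale {φ : E n → ℝ} (hφ : ContDiff ℝ ∞ φ) (x y : E n) {t : ℝ} (ht : t ≠ 0) :
    HasDerivAt (fun t => rescale φ x t y)
      (-((t ^ (n + 1))⁻¹ * radialDiv φ (t⁻¹ • (y - x)))) t := by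
  set w := t⁻¹ • (y - x) with hw
  have hd : HasFDerivAt φ (fderiv ℝ φ w) w := (hφ.differentiable (by simp) w).hasFDerivAt
  have h1 : HasDerivAt (fun t : ℝ => t⁻¹ • (y - x)) (-(t ^ 2)⁻¹ • (y - x)) t :=
    (hasDerivAt_inv ht).smul_const _
  have h2 : HasDerivAt (fun t : ℝ => (t ^ n)⁻¹) (-(n * t ^ (n - 1)) / (t ^ n) ^ 2) t :=
    (hasDerivAt_pow n t).inv (pow_ne_zero _ ht)
  refine (h2.mul (hd.comp_hasDerivAt t h1)).congr_deriv ?_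
  have h3 : -(t ^ 2)⁻¹ • (y - x) = -t⁻¹ • w := by
    rw [hw, smul_smul]; congr 1; field_simp
  -- The case n = 0 is separate because `n - 1` truncates there.
  have h4 : (n : ℝ) * t ^ (n - 1) = n * t ^ n * t⁻¹ := by
    rcases n with _ | k
    · simp
    · rw [Nat.add_sub_cancel, pow_succ]; field_simp
  rw [h3, h4, radialDiv, map_smul]
  simp only [smul_eq_mul, Function.comp, ← hw]
  field_simp
  ring

theorem integrable_L2_mul {U : Set (E n)} [IsFiniteMeasure (volume.restrict U)] (u : L2 U)
    {f : E n → ℝ} (hf : Continuous f) (hc : HasCompactSupport f) :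
    IntegrableOn (fun y => u y * f y) U := by
  obtain ⟨M, hM⟩ := hf.bounded_above_of_compact_support hc
  exact ((Lp.memLp u).integrable (by norm_num)).mul_bdd hf.aestronglyMeasurable
    (Eventually.of_forall hM)

/-- The weighted mean of `u` over `x + t • tsupport φ`. -/
def mean {U : Set (E n)} (u : L2 U) (φ : E n → ℝ) (x : E n) (t : ℝ) : ℝ :=
  ∫ y in U, u y * rescale φ x t y

/-- Differentiate under the integral, recognise a divergence, and integrate by parts. Membership of
`x` in `coneSet U K` keeps the supports of the weights inside U, so they are legitimate test
functions. -/
theorem hasDerivAt_mean {U K : Set (E n)} [IsFiniteMeasure (volume.restrict U)]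
    (hcK : IsCompact K) {u : L2 U} {v : Fin n → L2 U}
    (hv : ∀ i, HasWeakDeriv U (Pi.single i 1) u (v i)) {φ : E n → ℝ} (hφ : ContDiff ℝ ∞ φ)
    (hK : tsupport φ ⊆ K) {x : E n} (hx : x ∈ coneSet U K) {t : ℝ} (ht : t ∈ Ioc (0 : ℝ) 1) :
    HasDerivAt (mean u φ x) (∑ i, mean (v i) (coordMul i φ) x t) t := by
  have hcφ : HasCompactSupport φ := hcK.of_isClosed_subset (isClosed_tsupport _) hK
  obtain ⟨M, hM⟩ := (continuous_radialDiv hφ).bounded_above_of_compact_support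
    (hasCompactSupport_radialDiv hcφ)
  have hM0 : 0 ≤ M := (norm_nonneg _).trans (hM 0)
  have ht0 := ht.1
  have hKi : ∀ i, tsupport (coordMul i φ) ⊆ K := fun i => (tsupport_coordMul_subset i φ).trans hK
  have hsum : ∑ i, mean (v i) (coordMul i φ) x t =
      ∫ y in U, u y * -((t ^ (n + 1))⁻¹ * radialDiv φ (t⁻¹ • (y - x))) := by
    have h1 : ∀ i, mean (v i) (coordMul i φ) x t =
        -∫ y in U, u y * pderiv i (rescale (coordMul i φ) x t) y := by
      intro i
      rw [(hv i).integral_mul_pderiv (contDiff_rescale (contDiff_coordMul i hφ) x t)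
        (hasCompactSupport_rescale hcK (hKi i) x ht0.ne')
        (tsupport_rescale_subset_of_mem (hKi i) hx ht), neg_neg, mean]
    simp_rw [h1, Finset.sum_neg_distrib]
    rw [← integral_finsetSum, ← integral_neg]
    · simp_rw [← Finset.mul_sum, sum_pderiv_rescale_coordMul hφ, mul_neg]
    · intro i _
      have hs := contDiff_rescale (contDiff_coordMul i hφ) x t
      exact integrable_L2_mul u (contDiff_pderiv i hs).continuous
        ((hasCompactSupport_rescale hcK (hKi i) x ht0.ne').of_isClosed_subset
          (isClosed_tsupport _) (tsupport_pderiv_subset i _))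
  rw [hsum]
  have hu : Integrable u (volume.restrict U) := (Lp.memLp u).integrable (by norm_num)
  -- Staying above t/2 bounds s^(-(n+1)) uniformly, which supplies the dominating function.
  have hnear : Ioi (t / 2) ∈ 𝓝 t := Ioi_mem_nhds (by linarith)
  refine (hasDerivAt_integral_of_dominated_loc_of_deriv_le
    (F := fun s y => u y * rescale φ x s y)
    (F' := fun s y => u y * -((s ^ (n + 1))⁻¹ * radialDiv φ (s⁻¹ • (y - x))))
    (bound := fun y => ‖u y‖ * (((t / 2) ^ (n + 1))⁻¹ * M))
    hnear ?_ ?_ ?_ ?_ ?_ ?_).2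
  · exact Eventually.of_forall fun s => (Lp.aestronglyMeasurable u).mul
      (contDiff_rescale hφ x s).continuous.aestronglyMeasurable
  · exact integrable_L2_mul u (contDiff_rescale hφ x t).continuous
      (hasCompactSupport_rescale hcK hK x ht0.ne')
  · refine (Lp.aestronglyMeasurable u).mul (Continuous.aestronglyMeasurable ?_)
    exact (continuous_const.mul ((continuous_radialDiv hφ).comp (by fun_prop))).neg
  · refine Eventually.of_forall fun y s hs => ?_
    have hs' : t / 2 < s := hs
    have hs0 : 0 < s := by linarith
    rw [norm_mul, norm_neg, norm_mul, norm_inv, norm_pow, Real.norm_of_nonneg hs0.le]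
    gcongr
    exact hM _
  · exact hu.norm.mul_const _
  · refine Eventually.of_forall fun y s hs => ?_
    have hs' : t / 2 < s := hs
    exact (hasDerivAt_rescale hφ x y (by linarith)).const_mul _

/-! ### Bounds for the averages -/

theorem integral_rescale_pow (φ : E n → ℝ) (x : E n) {t : ℝ} (ht : 0 < t) (k : ℕ) :
    ∫ y, rescale φ x t y ^ k = ((t ^ n)⁻¹) ^ k * (t ^ n * ∫ z, φ z ^ k) := by
  simp_rw [rescale, mul_pow]
  rw [integral_const_mul, integral_sub_right_eq_self (fun y => φ (t⁻¹ • y) ^ k) x,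
    Measure.integral_comp_smul volume (fun z => φ z ^ k) t⁻¹]
  simp [abs_of_pos ht]

theorem memLp_two_of_compact_support {f : E n → ℝ} (hf : Continuous f) (hc : HasCompactSupport f)
    (U : Set (E n)) : MemLp f 2 (volume.restrict U) :=
  (hf.memLp_of_hasCompactSupport hc).restrict U

theorem sq_inner_le {H : Type*} [NormedAddCommGroup H] [InnerProductSpace ℝ H] (u g : H) :
    (inner ℝ u g) ^ 2 ≤ ‖u‖ ^ 2 * ‖g‖ ^ 2 := by
  rw [← mul_pow]
  exact sq_le_sq.2 ((abs_real_inner_le_norm u g).trans (le_abs_self _))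

theorem sq_integral_mul_le {U : Set (E n)} (u : L2 U) {f : E n → ℝ} (hf : Continuous f)
    (hc : HasCompactSupport f) : (∫ y in U, u y * f y) ^ 2 ≤ ‖u‖ ^ 2 * ∫ y, f y ^ 2 := by
  have hL := memLp_two_of_compact_support hf hc U
  obtain ⟨g, hg⟩ : ∃ g : L2 U, g =ᵐ[volume.restrict U] f := ⟨hL.toLp f, hL.coeFn_toLp⟩
  have h1 : ∫ y in U, u y * f y = inner ℝ u g := by
    rw [L2.inner_def]
    refine integral_congr_ae ?_
    filter_upwards [hg] with y hy
    simp [hy, mul_comm]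
  have h2 : ‖g‖ ^ 2 = ∫ y in U, f y ^ 2 := by
    rw [← real_inner_self_eq_norm_sq, L2.inner_def]
    refine integral_congr_ae ?_
    filter_upwards [hg] with y hy
    simp [hy, sq]
  have h3 : ∫ y in U, f y ^ 2 ≤ ∫ y, f y ^ 2 := by
    refine setIntegral_le_integral ?_ (Eventually.of_forall fun y => sq_nonneg _)
    have hc2 : HasCompactSupport fun y => f y ^ 2 := by
      simp_rw [sq]
      exact hc.mul_left
    exact Continuous.integrable_of_hasCompactSupport (by fun_prop) hc2
  rw [h1]
  refine (sq_inner_le u g).trans ?_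
  rw [h2]
  exact mul_le_mul_of_nonneg_left h3 (sq_nonneg _)

/-- Cauchy–Schwarz: the L² norm of the rescaled weight is t^(-n/2) times that of φ. -/
theorem exists_abs_mean_le {U : Set (E n)} (u : L2 U) {φ : E n → ℝ} (hφ : ContDiff ℝ ∞ φ)
    (hc : HasCompactSupport φ) :
    ∃ C, 0 ≤ C ∧ ∀ x : E n, ∀ t : ℝ, 0 < t → |mean u φ x t| ≤ C * t ^ (-(n / 2 : ℝ)) := by
  have hI : 0 ≤ ∫ z, φ z ^ 2 := integral_nonneg fun z => sq_nonneg _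
  refine ⟨‖u‖ * √(∫ z, φ z ^ 2), by positivity, fun x t ht => ?_⟩
  have h := sq_integral_mul_le u (contDiff_rescale hφ x t).continuous
    (hasCompactSupport_rescale hc subset_rfl x ht.ne')
  rw [integral_rescale_pow φ x ht] at h
  refine abs_le_of_sq_le_sq ?_ (by positivity)
  refine h.trans (le_of_eq ?_)
  have ht2 : (t ^ (-(n / 2 : ℝ))) ^ 2 = (t ^ n)⁻¹ := by
    rw [← Real.rpow_natCast, ← Real.rpow_mul ht.le, ← Real.rpow_natCast t n, ← Real.rpow_neg ht.le]
    congr 1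
    push_cast
    ring
  rw [mul_pow, mul_pow, Real.sq_sqrt hI, ht2]
  field_simp

/-- The right-hand side is C times the integral of s^(-(b+1)) from t to 1. Both signs of `b` are
needed: positive ones lower the singularity, and b = -1/2 removes it. -/
theorem abs_sub_le_of_abs_deriv_le_rpow {g g' : ℝ → ℝ} {C b : ℝ} (hb : b ≠ 0)
    (hg : ∀ t ∈ Ioc (0 : ℝ) 1, HasDerivAt g (g' t) t)
    (hg' : ∀ t ∈ Ioc (0 : ℝ) 1, |g' t| ≤ C * t ^ (-(b + 1))) {t : ℝ} (ht : t ∈ Ioc (0 : ℝ) 1) :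
    |g 1 - g t| ≤ C * ((t ^ (-b) - 1) / b) := by
  have hpos : ∀ s ∈ Icc t 1, s ∈ Ioc (0 : ℝ) 1 := fun s hs => ⟨ht.1.trans_le hs.1, hs.2⟩
  have hB : ∀ s ∈ Icc t 1,
      HasDerivAt (fun s : ℝ => C * ((t ^ (-b) - s ^ (-b)) / b)) (C * s ^ (-(b + 1))) s := by
    intro s hs
    have h := (((Real.hasDerivAt_rpow_const (p := -b) (Or.inl (hpos s hs).1.ne')).const_sub
      (t ^ (-b))).div_const b).const_mul C
    refine h.congr_deriv ?_
    rw [show -b - 1 = -(b + 1) by ring]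
    field_simp
  have := image_norm_le_of_norm_deriv_right_le_deriv_boundary' (a := t) (b := 1)
    (f := fun s => g s - g t) (f' := g')
    (fun s hs => ((hg s (hpos s hs)).sub_const _).continuousAt.continuousWithinAt)
    (fun s hs => ((hg s (hpos s (Ico_subset_Icc_self hs))).sub_const _).hasDerivWithinAt)
    (B := fun s : ℝ => C * ((t ^ (-b) - s ^ (-b)) / b)) (B' := fun s => C * s ^ (-(b + 1)))
    (by simp) (fun s hs => (hB s hs).continuousAt.continuousWithinAt)
    (fun s hs => (hB s (Ico_subset_Icc_self hs)).hasDerivWithinAt)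
    (fun s hs => hg' s (hpos s (Ico_subset_Icc_self hs))) (right_mem_Icc.2 ht.2)
  simpa using this

theorem exists_abs_sum_mean_le {U K : Set (E n)} {v : Fin n → L2 U} {φ : Fin n → E n → ℝ} {b : ℝ}
    (h : ∀ i, ∃ C, 0 ≤ C ∧ ∀ x ∈ coneSet U K, ∀ t ∈ Ioc (0 : ℝ) 1,
      |mean (v i) (φ i) x t| ≤ C * t ^ (-b)) :
    ∃ C, 0 ≤ C ∧ ∀ x ∈ coneSet U K, ∀ t ∈ Ioc (0 : ℝ) 1,
      |∑ i, mean (v i) (φ i) x t| ≤ C * t ^ (-b) := by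
  choose C hC0 hC using h
  refine ⟨∑ i, C i, Finset.sum_nonneg fun i _ => hC0 i, fun x hx t ht => ?_⟩
  rw [Finset.sum_mul]
  exact (Finset.abs_sum_le_sum_abs _ _).trans (Finset.sum_le_sum fun i _ => hC i x hx t ht)

/-- Each available derivative gains one power of t: a bound t^(-(b+1)) for the averages of the first
derivatives integrates to t^(-b). Keeping b > 0 avoids the logarithmic case. -/
theorem MemH.exists_abs_mean_le {U K : Set (E n)} [IsFiniteMeasure (volume.restrict U)]
    (hcK : IsCompact K) (k : ℕ) : ∀ {b : ℝ}, 0 < b → (n : ℝ) / 2 ≤ b + k → ∀ {u : L2 U},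
    MemH U k u → ∀ {φ : E n → ℝ}, ContDiff ℝ ∞ φ → tsupport φ ⊆ K →
    ∃ C, 0 ≤ C ∧ ∀ x ∈ coneSet U K, ∀ t ∈ Ioc (0 : ℝ) 1, |mean u φ x t| ≤ C * t ^ (-b) := by
  induction k with
  | zero =>
    intro b hb hn u _ φ hφ hK
    obtain ⟨C, hC0, hC⟩ := BVP.exists_abs_mean_le u hφ
      (hcK.of_isClosed_subset (isClosed_tsupport _) hK)
    refine ⟨C, hC0, fun x _ t ht => (hC x t ht.1).trans ?_⟩
    gcongr C * ?_
    refine Real.rpow_le_rpow_of_exponent_ge ht.1 ht.2 ?_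
    simp at hn
    linarith
  | succ k ih =>
    intro b hb hn u hu φ hφ hK
    choose v hv hvk using hu.exists_weakDeriv
    obtain ⟨C₀, hC₀0, hC₀⟩ := BVP.exists_abs_mean_le u hφ
      (hcK.of_isClosed_subset (isClosed_tsupport _) hK)
    obtain ⟨C, hC0, hC⟩ := exists_abs_sum_mean_le (b := b + 1) fun i =>
      ih (by linarith) (by push_cast at hn; linarith) (hvk i) (contDiff_coordMul i hφ)
        ((tsupport_coordMul_subset i φ).trans hK)
    refine ⟨C₀ + C / b, by positivity, fun x hx t ht => ?_⟩
    have h1 := abs_sub_le_of_abs_deriv_le_rpow hb.ne'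
      (fun s hs => hasDerivAt_mean hcK hv hφ hK hx hs) (hC x hx) ht
    have h2 := hC₀ x 1 one_pos
    rw [Real.one_rpow, mul_one] at h2
    have h3 : 1 ≤ t ^ (-b) := Real.one_le_rpow_of_pos_of_le_one_of_nonpos ht.1 ht.2 (by linarith)
    have h4 : |mean u φ x t| ≤ |mean u φ x 1| + |mean u φ x 1 - mean u φ x t| := by
      rw [abs_sub_comm]
      have := abs_add_le (mean u φ x 1) (mean u φ x t - mean u φ x 1)
      rwa [add_sub_cancel] at this
    have h5 : C * ((t ^ (-b) - 1) / b) ≤ C / b * t ^ (-b) := by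
      rw [mul_div_assoc', div_mul_eq_mul_div]
      gcongr
      linarith
    have h6 : C₀ ≤ C₀ * t ^ (-b) := le_mul_of_one_le_right hC₀0 h3
    linarith

/-- The last integration: the averages of the first derivatives are O(t^(-1/2)), which is integrable
at 0. -/
theorem MemH.exists_abs_mean_le_const {U K : Set (E n)} [IsFiniteMeasure (volume.restrict U)]
    (hcK : IsCompact K) {m : ℕ} (hm : (n : ℝ) / 2 < m) {u : L2 U} (hu : MemH U m u)
    {φ : E n → ℝ} (hφ : ContDiff ℝ ∞ φ) (hK : tsupport φ ⊆ K) :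
    ∃ C, ∀ x ∈ coneSet U K, ∀ t ∈ Ioc (0 : ℝ) 1, |mean u φ x t| ≤ C := by
  have hm0 : m ≠ 0 := by
    rintro rfl
    have : (0 : ℝ) ≤ (n : ℝ) / 2 := by positivity
    simp at hm
    linarith
  obtain ⟨k, rfl⟩ := Nat.exists_eq_succ_of_ne_zero hm0
  -- Integrality sharpens n < 2m to n + 1 ≤ 2m; this leaves the half power of t used below.
  have hnk : n + 1 ≤ 2 * (k + 1) := by
    have : (n : ℝ) < 2 * ((k + 1 : ℕ) : ℝ) := by
      have := hm
      simp only [Nat.succ_eq_add_one] at this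
      linarith
    exact_mod_cast this
  have hnk' : (n : ℝ) + 1 ≤ 2 * (k + 1) := by exact_mod_cast hnk
  choose v hv hvk using hu.exists_weakDeriv
  obtain ⟨C₀, hC₀0, hC₀⟩ := BVP.exists_abs_mean_le u hφ
    (hcK.of_isClosed_subset (isClosed_tsupport _) hK)
  -- The exponent 1/2 is written as b + 1 with b = -1/2, to match `abs_sub_le_of_abs_deriv_le_rpow`.
  obtain ⟨C, hC0, hC⟩ := exists_abs_sum_mean_le (b := -(1 / 2) + 1) fun i =>
    MemH.exists_abs_mean_le hcK k (b := -(1 / 2) + 1) (by norm_num) (by linarith) (hvk i)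
      (contDiff_coordMul i hφ) ((tsupport_coordMul_subset i φ).trans hK)
  refine ⟨C₀ + C * 2, fun x hx t ht => ?_⟩
  have h1 := abs_sub_le_of_abs_deriv_le_rpow (b := -(1 / 2)) (by norm_num)
    (fun s hs => hasDerivAt_mean hcK hv hφ hK hx hs) (hC x hx) ht
  have h2 := hC₀ x 1 one_pos
  rw [Real.one_rpow, mul_one] at h2
  have h3 : 0 ≤ t ^ (-(-(1 / 2)) : ℝ) := Real.rpow_nonneg ht.1.le _
  have h4 : |mean u φ x t| ≤ |mean u φ x 1| + |mean u φ x 1 - mean u φ x t| := by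
    rw [abs_sub_comm]
    have := abs_add_le (mean u φ x 1) (mean u φ x t - mean u φ x 1)
    rwa [add_sub_cancel] at this
  have h5 : C * ((t ^ (-(-(1 / 2)) : ℝ) - 1) / (-(1 / 2))) ≤ C * 2 := by
    gcongr
    linarith
  linarith

/-- The averages converge almost everywhere. -/
theorem ae_tendsto_mean {U : Set (E n)} (hU : MeasurableSet U)
    [IsFiniteMeasure (volume.restrict U)] (u : L2 U) {φ : E n → ℝ} (hφ : ContDiff ℝ ∞ φ)
    (hc : HasCompactSupport φ) (hone : ∫ z, φ z = 1) :
    ∀ᵐ x ∂volume.restrict U, Tendsto (mean u φ x) (𝓝[>] 0) (𝓝 (u x)) := by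
  set f : E n → ℝ := U.indicator u with hf
  have hfi : Integrable f := by
    rw [hf, integrable_indicator_iff hU]
    exact (Lp.memLp u).integrable (by norm_num)
  obtain ⟨M, hM⟩ := hφ.continuous.bounded_above_of_compact_support hc
  have hM0 : 0 ≤ M := (norm_nonneg _).trans (hM 0)
  obtain ⟨R, hR0, hR⟩ : ∃ R : ℝ, 0 < R ∧ tsupport φ ⊆ Metric.closedBall 0 R :=
    hc.isCompact.isBounded.subset_closedBall_lt 0 0
  have hleb := IsUnifLocDoublingMeasure.ae_tendsto_average_norm_sub (μ := (volume : Measure (E n)))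
    hfi.locallyIntegrable 1
  filter_upwards [ae_restrict_of_ae hleb, ae_restrict_mem hU] with x hx hxU
  have hfx : f x = u x := indicator_of_mem hxU _
  have hlim := hx (l := 𝓝[>] (0 : ℝ)) (fun _ => x) (fun t => R * t) (by
    refine tendsto_nhdsWithin_iff.2 ⟨?_, ?_⟩
    · have : Tendsto (fun t : ℝ => R * t) (𝓝 0) (𝓝 (R * 0)) := (continuous_const_mul R).tendsto 0
      rw [mul_zero] at this
      exact this.mono_left nhdsWithin_le_nhds
    · filter_upwards [self_mem_nhdsWithin] with t ht using mul_pos hR0 ht) (by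
    filter_upwards [self_mem_nhdsWithin] with t ht
    exact Metric.mem_closedBall_self (by have := mul_pos hR0 ht; linarith))
  set V : ℝ := volume.real (Metric.ball (0 : E n) 1) with hV
  rw [tendsto_iff_norm_sub_tendsto_zero]
  -- The weight is at most M t^(-n) and vanishes off the ball of radius Rt, whose volume is (Rt)^n
  -- V. So the error is at most M R^n V times the mean oscillation, which tends to 0 at Lebesgue
  -- points.
  have hlim' := hlim.const_mul (M * R ^ n * V)
  rw [mul_zero] at hlim'
  refine squeeze_zero' (Eventually.of_forall fun t => norm_nonneg _) ?_ hlim'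
  filter_upwards [self_mem_nhdsWithin] with t ht
  have ht0 : (0 : ℝ) < t := ht
  have hcont := (contDiff_rescale hφ x t).continuous
  have hcomp := hasCompactSupport_rescale hc subset_rfl x ht0.ne'
  have hri : Integrable (rescale φ x t) := hcont.integrable_of_hasCompactSupport hcomp
  have hint1 : ∫ y, rescale φ x t y = 1 := by
    have := integral_rescale_pow φ x ht0 1
    simp only [pow_one, hone, mul_one] at this
    rw [this, inv_mul_cancel₀ (by positivity)]
  have hmean : mean u φ x t = ∫ y, f y * rescale φ x t y := by
    rw [mean, ← integral_indicator hU]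
    refine integral_congr_ae (Eventually.of_forall fun y => ?_)
    by_cases hy : y ∈ U <;> simp [f, hy]
  have hfr : Integrable fun y => f y * rescale φ x t y := by
    obtain ⟨N, hN⟩ := hcont.bounded_above_of_compact_support hcomp
    exact hfi.mul_bdd hcont.aestronglyMeasurable (Eventually.of_forall hN)
  have hdiff : mean u φ x t - u x =
      ∫ y in Metric.closedBall x (R * t), (f y - f x) * rescale φ x t y := by
    have h1 : mean u φ x t - u x = ∫ y, (f y - f x) * rescale φ x t y := by
      simp_rw [sub_mul]
      rw [integral_sub hfr (hri.const_mul _), integral_const_mul, hint1, hmean, hfx, mul_one]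
    rw [h1]
    refine (setIntegral_eq_integral_of_forall_compl_eq_zero fun y hy => ?_).symm
    have : rescale φ x t y = 0 := by
      by_contra hne
      obtain ⟨z, hz, rfl⟩ := tsupport_rescale_subset hR x ht0.ne' (subset_tsupport _ hne)
      apply hy
      rw [mem_closedBall_iff_norm, add_sub_cancel_left, norm_smul, Real.norm_of_nonneg ht0.le,
        mul_comm]
      gcongr
      exact mem_closedBall_zero_iff.1 hz
    rw [this, mul_zero]
  have hvol : volume.real (Metric.closedBall x (R * t)) = (R * t) ^ n * V := by
    rw [hV, measureReal_def, Measure.addHaar_closedBall _ _ (by positivity), ENNReal.toReal_mul,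
      ENNReal.toReal_ofReal (by positivity)]
    simp [measureReal_def]
  have hV0 : 0 < V := by
    rw [hV, measureReal_def]
    exact ENNReal.toReal_pos (Metric.measure_ball_pos _ _ one_pos).ne' measure_ball_lt_top.ne
  rw [hdiff]
  have hfin : IsFiniteMeasure (volume.restrict (Metric.closedBall x (R * t))) :=
    isFiniteMeasure_restrict.2 measure_closedBall_lt_top.ne
  calc ‖∫ y in Metric.closedBall x (R * t), (f y - f x) * rescale φ x t y‖
      ≤ ∫ y in Metric.closedBall x (R * t), ‖f y - f x‖ * ((t ^ n)⁻¹ * M) := by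
        refine norm_integral_le_of_norm_le ?_ (Eventually.of_forall fun y => ?_)
        · exact ((hfi.restrict.sub (integrable_const _)).norm).mul_const _
        · rw [norm_mul, rescale, norm_mul, norm_inv, norm_pow, Real.norm_of_nonneg ht0.le]
          gcongr
          exact hM _
    _ = M * R ^ n * V * ⨍ y in Metric.closedBall x (R * t), ‖f y - f x‖ := by
        rw [integral_mul_const, setAverage_eq, hvol, smul_eq_mul, mul_pow]
        field_simp
    _ = _ := rfl

/-- Sobolev's inequality at points that are vertices of cones in `U`. -/
theorem MemH.ae_abs_le_of_mem_coneSet {U : Set (E n)} (hU : MeasurableSet U)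
    [IsFiniteMeasure (volume.restrict U)] {m : ℕ} (hm : (n : ℝ) / 2 < m) {u : L2 U}
    (hu : MemH U m u) (e : E n) {δ : ℝ} (hδ : 0 < δ) :
    ∃ C, ∀ᵐ x ∂volume.restrict U, x ∈ coneSet U (Metric.closedBall e δ) → |u x| ≤ C := by
  let ψ : ContDiffBump e := ⟨δ / 2, δ, by positivity, by linarith⟩
  have hφ : ContDiff ℝ ∞ (ψ.normed (volume : Measure (E n))) := ψ.contDiff_normed
  have hK : tsupport (ψ.normed (volume : Measure (E n))) ⊆ Metric.closedBall e δ :=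
    (ψ.tsupport_normed_eq (μ := volume)).subset
  obtain ⟨C, hC⟩ := hu.exists_abs_mean_le_const (isCompact_closedBall e δ) hm hφ hK
  refine ⟨C, ?_⟩
  filter_upwards [ae_tendsto_mean hU u hφ ψ.hasCompactSupport_normed ψ.integral_normed]
    with x hx hxK
  refine le_of_tendsto hx.abs ?_
  filter_upwards [Ioc_mem_nhdsGT one_pos] with t ht using hC x hxK t ht

/-! ### Interior cones -/

/-- Moving against the gradient decreases ρ. Strict differentiability makes the linear approximation
uniform in the base point, so one cone serves all points of U near x₀. -/
theorem IsLocalDefiningFunction.exists_cone {U V : Set (E n)} {x₀ : E n} {ρ : E n → ℝ}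
    (h : IsLocalDefiningFunction U x₀ V ρ) :
    ∃ W ∈ 𝓝 x₀, ∃ (e : E n) (δ : ℝ), 0 < δ ∧ ∀ x ∈ W, x ∈ U →
      x ∈ coneSet U (Metric.closedBall e δ) := by
  have hV : V ∈ 𝓝 x₀ := h.isOpen.mem_nhds h.mem
  have hs : HasStrictFDerivAt ρ (fderiv ℝ ρ x₀) x₀ :=
    (h.contDiffOn.contDiffAt hV).hasStrictFDerivAt (by simp)
  set g := gradient ρ x₀ with hg
  have hD : ∀ v, fderiv ℝ ρ x₀ v = inner ℝ g v := fun v => by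
    rw [hg, gradient, InnerProductSpace.toDual_symm_apply]
  have hN : 0 < ‖g‖ := norm_pos_iff.2 h.gradient_ne_zero
  have hev := (hs.isLittleO.def (c := ‖g‖ / 4) (by positivity)).and
    ((continuous_fst.tendsto (x₀, x₀)).eventually (show ∀ᶠ y in 𝓝 x₀, y ∈ V from hV))
  obtain ⟨r, hr, hball⟩ := Metric.eventually_nhds_iff_ball.1 hev
  have hloc : ∀ y ∈ Metric.ball x₀ r, ∀ x ∈ Metric.ball x₀ r,
      |ρ y - ρ x - inner ℝ g (y - x)| ≤ ‖g‖ / 4 * ‖y - x‖ ∧ y ∈ V := by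
    intro y hy x hx
    have := hball (y, x) (by rw [← ball_prod_same]; exact ⟨hy, hx⟩)
    simpa [hD] using this
  -- With g the gradient and z within s‖g‖/2 of -s • g, one has ‖z‖ ≤ 3r/8, so x + t • z stays in
  -- the ball. The linear decrease is at least t s‖g‖²/2 and beats the error of at most 3t s‖g‖²/8.
  set s := r / (4 * ‖g‖) with hsdef
  have hs0 : 0 < s := by positivity
  have hsr : s * ‖g‖ = r / 4 := by rw [hsdef]; field_simp
  refine ⟨Metric.ball x₀ (r / 2), Metric.ball_mem_nhds _ (by positivity), -s • g, s * ‖g‖ / 2,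
    by positivity, fun x hx hxU t ht z hz => ?_⟩
  have hz' : ‖z - -s • g‖ ≤ s * ‖g‖ / 2 := mem_closedBall_iff_norm.1 hz
  have hzn : ‖z‖ ≤ 3 / 2 * (s * ‖g‖) := by
    have h1 : ‖-s • g‖ = s * ‖g‖ := by rw [norm_smul, norm_neg, Real.norm_of_nonneg hs0.le]
    have h2 := norm_add_le (z - -s • g) (-s • g)
    rw [sub_add_cancel, h1] at h2
    linarith
  have hzi : inner ℝ g z ≤ -(s * ‖g‖ * ‖g‖) / 2 := by
    have h1 : inner ℝ g z = inner ℝ g (z - -s • g) + inner ℝ g (-s • g) := by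
      rw [← inner_add_right, sub_add_cancel]
    have h2 : inner ℝ g (-s • g) = -(s * ‖g‖ * ‖g‖) := by
      rw [inner_smul_right, real_inner_self_eq_norm_sq]; ring
    have h3 : inner ℝ g (z - -s • g) ≤ ‖g‖ * (s * ‖g‖ / 2) :=
      (real_inner_le_norm _ _).trans (by gcongr)
    rw [h1, h2]
    linarith
  have hxr : x ∈ Metric.ball x₀ r := Metric.ball_subset_ball (by linarith) hx
  have htz : ‖t • z‖ = t * ‖z‖ := by rw [norm_smul, Real.norm_of_nonneg ht.1.le]
  have hyr : x + t • z ∈ Metric.ball x₀ r := by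
    rw [mem_ball_iff_norm] at hx ⊢
    have h1 : x + t • z - x₀ = (x - x₀) + t • z := by abel
    have h2 := norm_add_le (x - x₀) (t • z)
    have h3 : t * ‖z‖ ≤ 1 * ‖z‖ := by gcongr; exact ht.2
    rw [h1]
    linarith
  have hxV := (hloc x hxr x hxr).2
  obtain ⟨hy1, hyV⟩ := hloc _ hyr x hxr
  rw [h.mem_iff _ hyV]
  have hxρ := (h.mem_iff x hxV).1 hxU
  rw [add_sub_cancel_left, htz, inner_smul_right] at hy1
  have h1 := (abs_le.1 hy1).2
  have h2 : t * (inner ℝ g z + ‖g‖ / 4 * ‖z‖) ≤ 0 := by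
    refine mul_nonpos_of_nonneg_of_nonpos ht.1.le ?_
    have : ‖g‖ / 4 * ‖z‖ ≤ ‖g‖ / 4 * (3 / 2 * (s * ‖g‖)) := by gcongr
    have h0 : 0 < s * ‖g‖ * ‖g‖ := by positivity
    linarith
  linarith

theorem exists_cone_of_mem_closure {U : Set (E n)} (hU : IsOpen U) (hb : HasSmoothBoundary U)
    {x₀ : E n} (hx₀ : x₀ ∈ closure U) :
    ∃ W ∈ 𝓝 x₀, ∃ (e : E n) (δ : ℝ), 0 < δ ∧ ∀ x ∈ W, x ∈ U →
      x ∈ coneSet U (Metric.closedBall e δ) := by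
  by_cases h : x₀ ∈ U
  · obtain ⟨r, hr, hball⟩ := Metric.isOpen_iff.1 hU x₀ h
    refine ⟨Metric.ball x₀ (r / 2), Metric.ball_mem_nhds _ (by positivity), 0, r / 2,
      by positivity, fun x hx _ t ht z hz => hball ?_⟩
    rw [mem_ball_iff_norm] at hx ⊢
    have hz' : ‖z‖ ≤ r / 2 := mem_closedBall_zero_iff.1 hz
    have h1 : x + t • z - x₀ = (x - x₀) + t • z := by abel
    have h2 := norm_add_le (x - x₀) (t • z)
    have h3 : t * ‖z‖ ≤ 1 * ‖z‖ := by gcongr; exact ht.2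
    rw [h1]
    rw [norm_smul, Real.norm_of_nonneg ht.1.le] at h2
    linarith
  · obtain ⟨V, ρ, hρ⟩ := hb x₀ (by rw [hU.frontier_eq]; exact ⟨hx₀, h⟩)
    exact hρ.exists_cone

/-- **Sobolev embedding** `Hᵐ(U) ⊆ L^∞(U)` for `m > n / 2`. -/
theorem MemH.exists_ae_abs_le {U : Set (E n)} (hU : IsOpen U) (hbd : Bornology.IsBounded U)
    (hb : HasSmoothBoundary U) {m : ℕ} (hm : (n : ℝ) / 2 < m) {u : L2 U} (hu : MemH U m u) :
    ∃ C, ∀ᵐ x ∂volume.restrict U, |u x| ≤ C := by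
  have hfin : IsFiniteMeasure (volume.restrict U) := isFiniteMeasure_restrict.2 hbd.measure_lt_top.ne
  -- Compactness of the closure reduces the bound to finitely many neighbourhoods, each with its own
  -- cone.
  have key : ∃ C, ∀ᵐ x ∂volume.restrict U, x ∈ closure U → |u x| ≤ C := by
    refine hbd.isCompact_closure.induction_on
      (p := fun S => ∃ C, ∀ᵐ x ∂volume.restrict U, x ∈ S → |u x| ≤ C) ⟨0, by simp⟩ ?_ ?_ ?_
    · rintro S S' hSS ⟨C, hC⟩
      exact ⟨C, hC.mono fun x hx hxS => hx (hSS hxS)⟩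
    · rintro S S' ⟨C, hC⟩ ⟨C', hC'⟩
      refine ⟨max C C', ?_⟩
      filter_upwards [hC, hC'] with x hx hx' h
      exact h.elim (fun h => (hx h).trans (le_max_left _ _))
        (fun h => (hx' h).trans (le_max_right _ _))
    · intro x₀ hx₀
      obtain ⟨W, hW, e, δ, hδ, hcone⟩ := exists_cone_of_mem_closure hU hb hx₀
      obtain ⟨C, hC⟩ := hu.ae_abs_le_of_mem_coneSet hU.measurableSet hm e hδ
      refine ⟨W, mem_nhdsWithin_of_mem_nhds hW, C, ?_⟩
      filter_upwards [hC, ae_restrict_mem hU.measurableSet] with x hx hxU hxW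
      exact hx (hcone x hxW hxU)
  obtain ⟨C, hC⟩ := key
  refine ⟨C, ?_⟩
  filter_upwards [hC, ae_restrict_mem hU.measurableSet] with x hx hxU using hx (subset_closure hxU)

section Hilbert

variable {H : Type*} [NormedAddCommGroup H] [InnerProductSpace ℝ H]

/-! ### Hilbert–Schmidt operators -/

/-- Cauchy–Schwarz followed by Bessel's inequality. -/
theorem norm_sum_inner_smul_le {ι : Type*} {b : ι → H} (hb : Orthonormal ℝ b) (g : ι → H)
    (t : Finset ι) (f : H) :
    ‖∑ i ∈ t, (inner ℝ (b i) f : ℝ) • g i‖ ≤ √(∑ i ∈ t, ‖g i‖ ^ 2) * ‖f‖ := by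
  have h1 : ‖∑ i ∈ t, (inner ℝ (b i) f : ℝ) • g i‖ ≤ ∑ i ∈ t, ‖(inner ℝ (b i) f : ℝ)‖ * ‖g i‖ :=
    (norm_sum_le _ _).trans (Finset.sum_le_sum fun i _ => (norm_smul _ _).le)
  have h2 : (∑ i ∈ t, ‖(inner ℝ (b i) f : ℝ)‖ * ‖g i‖) ^ 2 ≤
      (√(∑ i ∈ t, ‖g i‖ ^ 2) * ‖f‖) ^ 2 := by
    rw [mul_pow, Real.sq_sqrt (Finset.sum_nonneg fun i _ => sq_nonneg _), mul_comm]
    refine (Finset.sum_mul_sq_le_sq_mul_sq _ _ _).trans ?_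
    gcongr
    exact hb.sum_inner_products_le f
  exact h1.trans (abs_le_of_sq_le_sq' h2 (by positivity)).2

/-- T is the operator-norm limit of the finite-rank partial sums of ⟨bᵢ, ·⟩ T bᵢ;
`norm_sum_inner_smul_le` gives the Cauchy property. -/
theorem isCompactOperator_of_summable_norm_sq [CompleteSpace H] {ι : Type*}
    (b : HilbertBasis ι ℝ H) (T : H →L[ℝ] H) (hT : Summable fun i => ‖T (b i)‖ ^ 2) :
    IsCompactOperator T := by
  set R : ι → H →L[ℝ] H := fun i => (innerSL ℝ (b i)).smulRight (T (b i)) with hR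
  have hsum : Summable R := by
    rw [summable_iff_vanishing_norm]
    intro ε hε
    obtain ⟨s, hs⟩ := summable_iff_vanishing_norm.1 hT ((ε / 2) ^ 2) (by positivity)
    refine ⟨s, fun t ht => ?_⟩
    have h1 := (le_abs_self _).trans_lt (hs t ht)
    have h2 : ‖∑ i ∈ t, R i‖ ≤ √(∑ i ∈ t, ‖T (b i)‖ ^ 2) := by
      refine ContinuousLinearMap.opNorm_le_bound _ (Real.sqrt_nonneg _) fun f => ?_
      have := norm_sum_inner_smul_le b.orthonormal (fun i => T (b i)) t f
      simpa [hR, _root_.sum_apply] using this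
    have h3 : √(∑ i ∈ t, ‖T (b i)‖ ^ 2) ≤ ε / 2 :=
      Real.sqrt_le_iff.2 ⟨by positivity, h1.le⟩
    linarith
  have hlim : HasSum R T := by
    have heq : ∑' i, R i = T := by
      ext f
      have h1 : HasSum (fun i => R i f) ((∑' i, R i) f) :=
        hsum.hasSum.mapL (ContinuousLinearMap.apply ℝ H f)
      have h2 := (b.hasSum_repr f).mapL T
      simp only [map_smul, b.repr_apply_apply] at h2
      exact h1.unique h2
    rw [← heq]
    exact hsum.hasSum
  refine isCompactOperator_of_tendsto (l := atTop) hlim (Eventually.of_forall fun s => ?_)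
  refine Submodule.sum_mem (compactOperator (RingHom.id ℝ) H H) (fun i _ => ?_)
  have h1 : IsCompactOperator (innerSL ℝ (b i)) :=
    isCompactOperator_of_locallyCompactSpace_dom (innerSL ℝ (b i))
  exact h1.clm_comp (ContinuousLinearMap.toSpanSingleton ℝ (T (b i)))

/-- A compact symmetric operator without negative eigenvalues is positive. -/
theorem inner_nonneg_of_eigenvalues_nonneg [CompleteSpace H] {T : H →L[ℝ] H}
    (hc : IsCompactOperator T) (hs : T.IsSymmetric)
    (hev : ∀ (c : ℝ) (v : H), v ≠ 0 → T v = c • v → 0 ≤ c) (f : H) : 0 ≤ inner ℝ (T f) f := by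
  -- By the spectral theorem it suffices to test finite sums of eigenvectors, where orthogonality
  -- turns the form into ∑ μ‖g μ‖².
  have hdense : Dense ((⨆ μ, Module.End.eigenspace (T : Module.End ℝ H) μ : Submodule ℝ H) :
      Set H) := by
    rw [Submodule.dense_iff_topologicalClosure_eq_top, Submodule.topologicalClosure_eq_top_iff]
    exact ContinuousLinearMap.orthogonalComplement_iSup_eigenspaces_eq_bot hc hs
  have hclosed : IsClosed {f : H | 0 ≤ inner ℝ (T f) f} :=
    isClosed_le continuous_const (T.continuous.inner continuous_id)
  refine hclosed.closure_subset_iff.2 ?_ (hdense f)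
  intro f hf
  obtain ⟨g, hg, rfl⟩ := (Submodule.mem_iSup_iff_exists_finsupp _ _).1 hf
  have hTg : ∀ μ, T (g μ) = μ • g μ := fun μ => Module.End.mem_eigenspace_iff.1 (hg μ)
  have horth : ∀ μ ν, μ ≠ ν → inner ℝ (g μ) (g ν) = 0 := fun μ ν hμν =>
    hs.orthogonalFamily_eigenspaces hμν ⟨g μ, hg μ⟩ ⟨g ν, hg ν⟩
  change 0 ≤ inner ℝ (T (∑ μ ∈ g.support, g μ)) (∑ μ ∈ g.support, g μ)
  rw [map_sum, sum_inner]
  refine Finset.sum_nonneg fun μ hμ => ?_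
  rw [inner_sum, Finset.sum_eq_single_of_mem μ hμ]
  · rw [hTg, real_inner_smul_left]
    exact mul_nonneg (hev μ (g μ) (Finsupp.mem_support_iff.1 hμ) (hTg μ)) real_inner_self_nonneg
  · intro ν _ hν
    rw [hTg, real_inner_smul_left, horth _ _ (Ne.symm hν), mul_zero]

end Hilbert

section Kernel

variable {α : Type*} [MeasurableSpace α] {μ : Measure α}

/-! ### Operators from `L²` to `L^∞` -/

/-- The set is an order interval between two constants, and the order on L² is closed. -/
theorem isClosed_ae_abs_le [IsFiniteMeasure μ] (k : ℝ) : IsClosed {g : Lp ℝ 2 μ | ∀ᵐ x ∂μ, |g x| ≤ k} := by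
  have h : {g : Lp ℝ 2 μ | ∀ᵐ x ∂μ, |g x| ≤ k} = {g | g ≤ Lp.const 2 μ k} ∩ {g | -g ≤ Lp.const 2 μ k} := by
    ext g
    simp only [mem_ofPred_eq, mem_inter_iff, ← Lp.coeFn_le]
    constructor
    · intro h
      constructor
      · filter_upwards [h, Lp.coeFn_const 2 μ k] with x hx hk
        rw [hk]; exact (abs_le.1 hx).2
      · filter_upwards [h, Lp.coeFn_const 2 μ k, Lp.coeFn_neg g] with x hx hk hn
        rw [hk, hn]; exact neg_le.1 (abs_le.1 hx).1
    · rintro ⟨h1, h2⟩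
      filter_upwards [h1, h2, Lp.coeFn_const 2 μ k, Lp.coeFn_neg g] with x hx1 hx2 hk hn
      rw [hk] at hx1 hx2
      rw [hn] at hx2
      exact abs_le.2 ⟨neg_le.1 hx2, hx1⟩
  rw [h]
  exact (isClosed_le continuous_id continuous_const).inter
    (isClosed_le continuous_neg continuous_const)

/-- Uniform boundedness through Baire: countably many closed sets cover L², so one of them contains
a ball. -/
theorem exists_ae_abs_le_mul_norm [IsFiniteMeasure μ] (T : Lp ℝ 2 μ →L[ℝ] Lp ℝ 2 μ)
    (hT : ∀ f, ∃ C : ℝ, ∀ᵐ x ∂μ, |T f x| ≤ C) :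
    ∃ C, 0 ≤ C ∧ ∀ f, ∀ᵐ x ∂μ, |T f x| ≤ C * ‖f‖ := by
  have hcl : ∀ k : ℕ, IsClosed {f : Lp ℝ 2 μ | ∀ᵐ x ∂μ, |T f x| ≤ k} := fun k =>
    (isClosed_ae_abs_le (k : ℝ)).preimage T.continuous
  have hcov : ⋃ k : ℕ, {f : Lp ℝ 2 μ | ∀ᵐ x ∂μ, |T f x| ≤ k} = univ := by
    refine eq_univ_of_forall fun f => mem_iUnion.2 ?_
    obtain ⟨C, hC⟩ := hT f
    obtain ⟨k, hk⟩ := exists_nat_ge C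
    exact ⟨k, hC.mono fun x hx => hx.trans hk⟩
  obtain ⟨k, f₀, hf₀⟩ := nonempty_interior_of_iUnion_of_closed hcl hcov
  obtain ⟨r, hr, hball⟩ := Metric.isOpen_iff.1 isOpen_interior f₀ hf₀
  have hmem : ∀ g ∈ Metric.ball f₀ r, ∀ᵐ x ∂μ, |T g x| ≤ k := fun g hg => by
    have h : g ∈ {f : Lp ℝ 2 μ | ∀ᵐ x ∂μ, |T f x| ≤ k} := interior_subset (hball hg)
    exact h
  refine ⟨4 * k / r, by positivity, fun f => ?_⟩
  rcases eq_or_ne f 0 with rfl | hf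
  · filter_upwards [Lp.coeFn_zero ℝ 2 μ] with x hx
    rw [map_zero, hx]
    simp
  have hfn : 0 < ‖f‖ := norm_pos_iff.2 hf
  -- This scaling puts f₀ + c • f inside the ball. Subtracting the bound at f₀ gives c|T f| ≤ 2k,
  -- hence the constant 4k/r.
  set c : ℝ := r / (2 * ‖f‖) with hc
  have hc0 : 0 < c := by positivity
  have hcf : ‖c • f‖ = r / 2 := by
    rw [norm_smul, Real.norm_of_nonneg hc0.le, hc]; field_simp
  have h1 := hmem (f₀ + c • f) (by
    rw [mem_ball_iff_norm, add_sub_cancel_left, hcf]; linarith)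
  have h2 := hmem f₀ (Metric.mem_ball_self hr)
  have h3 : T (f₀ + c • f) = T f₀ + c • T f := by rw [map_add, map_smul]
  rw [h3] at h1
  filter_upwards [h1, h2, Lp.coeFn_add (T f₀) (c • T f), Lp.coeFn_smul c (T f)]
    with x hx1 hx2 hadd hsmul
  rw [hadd, Pi.add_apply, hsmul, Pi.smul_apply, smul_eq_mul] at hx1
  have h4 : c * |T f x| ≤ 2 * k := by
    rw [← abs_of_pos hc0, ← abs_mul]
    have := abs_le.1 hx1
    have := abs_le.1 hx2
    exact abs_le.2 ⟨by linarith, by linarith⟩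
  have h5 : |T f x| ≤ 2 * k / c := by rw [le_div_iff₀ hc0]; linarith
  refine h5.trans (le_of_eq ?_)
  rw [hc]; field_simp; ring

theorem coeFn_sum_smul {ι : Type*} (s : Finset ι) (c : ι → ℝ) (g : ι → Lp ℝ 2 μ) :
    (∑ i ∈ s, c i • g i : Lp ℝ 2 μ) =ᵐ[μ] fun x => ∑ i ∈ s, c i * g i x := by
  classical
  induction s using Finset.induction_on with
  | empty => simp only [Finset.sum_empty]; exact Lp.coeFn_zero ℝ 2 μ
  | insert i s hi ih =>
    simp only [Finset.sum_insert hi]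
    filter_upwards [ih, Lp.coeFn_add (c i • g i) (∑ i ∈ s, c i • g i), Lp.coeFn_smul (c i) (g i)]
      with x hx hadd hsmul
    rw [hadd, Pi.add_apply, hx, hsmul, Pi.smul_apply, smul_eq_mul]

/-- Rational coefficients suffice by density, so that only countably many null sets arise in the
application. The choice c = v then gives the bound. -/
theorem sum_sq_le_of_rat_bound {ι : Type*} [Fintype ι] {v : ι → ℝ} {C : ℝ}
    (h : ∀ c : ι → ℚ, |∑ i, (c i : ℝ) * v i| ≤ C * √(∑ i, (c i : ℝ) ^ 2)) :
    ∑ i, v i ^ 2 ≤ C ^ 2 := by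
  have hd : DenseRange (Pi.map (fun (_ : ι) (q : ℚ) => (q : ℝ))) :=
    DenseRange.piMap fun _ => Rat.denseRange_cast
  have hall : ∀ c : ι → ℝ, |∑ i, c i * v i| ≤ C * √(∑ i, c i ^ 2) := fun c =>
    hd.induction_on (p := fun c : ι → ℝ => |∑ i, c i * v i| ≤ C * √(∑ i, c i ^ 2)) c
      (isClosed_le (by fun_prop) (by fun_prop)) h
  have h1 := hall v
  have hS : 0 ≤ ∑ i, v i ^ 2 := Finset.sum_nonneg fun i _ => sq_nonneg _
  simp_rw [← sq] at h1
  rw [abs_of_nonneg hS] at h1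
  have h2 := Real.sq_sqrt hS
  have h3 := Real.sqrt_nonneg (∑ i, v i ^ 2)
  set s := √(∑ i, v i ^ 2)
  rw [← h2] at h1 ⊢
  rcases h3.eq_or_lt with h0 | h0
  · rw [← h0, zero_pow two_ne_zero]; exact sq_nonneg C
  · have : s ≤ C := by
      by_contra! hlt
      nlinarith
    gcongr

theorem norm_sq_eq_integral (g : Lp ℝ 2 μ) : ‖g‖ ^ 2 = ∫ x, g x ^ 2 ∂μ := by
  rw [← real_inner_self_eq_norm_sq, L2.inner_def]
  simp [sq]

/-- For almost every x, evaluation f ↦ T f x has norm at most C on the span of finitely many bᵢ, so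
∑ |T bᵢ x|² ≤ C². Integrating over the finite measure bounds every partial sum. -/
theorem summable_norm_sq_apply [IsFiniteMeasure μ] (T : Lp ℝ 2 μ →L[ℝ] Lp ℝ 2 μ)
    (hT : ∀ f, ∃ C : ℝ, ∀ᵐ x ∂μ, |T f x| ≤ C) {ι : Type*} {b : ι → Lp ℝ 2 μ}
    (hb : Orthonormal ℝ b) : Summable fun i => ‖T (b i)‖ ^ 2 := by
  obtain ⟨C, hC0, hC⟩ := exists_ae_abs_le_mul_norm T hT
  refine summable_of_sum_le (c := C ^ 2 * μ.real univ) (fun i => sq_nonneg _) fun s => ?_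
  have hae : ∀ᵐ x ∂μ, ∀ c : s → ℚ,
      |∑ i : s, (c i : ℝ) * T (b i) x| ≤ C * √(∑ i : s, (c i : ℝ) ^ 2) := by
    refine ae_all_iff.2 fun c => ?_
    have hT' : T (∑ i : s, (c i : ℝ) • b i) = ∑ i : s, (c i : ℝ) • T (b i) := by
      rw [map_sum]; simp_rw [map_smul]
    have hn : ‖∑ i : s, (c i : ℝ) • b i‖ = √(∑ i : s, (c i : ℝ) ^ 2) := by
      have ho : Orthonormal ℝ fun i : s => b i := hb.comp _ Subtype.coe_injective
      have h1 := ho.inner_sum (fun i : s => (c i : ℝ)) (fun i : s => (c i : ℝ)) Finset.univ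
      rw [real_inner_self_eq_norm_sq] at h1
      rw [← Real.sqrt_sq (norm_nonneg _), h1]
      simp [sq]
    filter_upwards [hC (∑ i : s, (c i : ℝ) • b i),
      coeFn_sum_smul Finset.univ (fun i : s => (c i : ℝ)) (fun i : s => T (b i))] with x hx hsum
    rw [hT', hsum, hn] at hx
    exact hx
  have hint : ∀ i, Integrable (fun x => T (b i) x ^ 2) μ := fun i => (Lp.memLp (T (b i))).integrable_sq
  calc ∑ i ∈ s, ‖T (b i)‖ ^ 2 = ∫ x, ∑ i ∈ s, T (b i) x ^ 2 ∂μ := by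
        rw [integral_finsetSum _ fun i _ => hint i]
        exact Finset.sum_congr rfl fun i _ => norm_sq_eq_integral _
    _ ≤ ∫ _, C ^ 2 ∂μ := by
        refine integral_mono_ae (integrable_finsetSum _ fun i _ => hint i) (integrable_const _) ?_
        filter_upwards [hae] with x hx
        rw [← Finset.sum_coe_sort s fun i => T (b i) x ^ 2]
        exact sum_sq_le_of_rat_bound hx
    _ = C ^ 2 * μ.real univ := by simp [mul_comm]

/-! ### Integral kernels -/

theorem exists_tensor [SFinite μ] (g f : Lp ℝ 2 μ) :
    ∃ F : Lp ℝ 2 (μ.prod μ), F =ᵐ[μ.prod μ] fun p => g p.1 * f p.2 := by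
  have hm : AEStronglyMeasurable (fun p : α × α => g p.1 * f p.2) (μ.prod μ) :=
    (Lp.aestronglyMeasurable g).comp_fst.mul (Lp.aestronglyMeasurable f).comp_snd
  have h : MemLp (fun p : α × α => g p.1 * f p.2) 2 (μ.prod μ) := by
    rw [memLp_two_iff_integrable_sq hm]
    simp_rw [mul_pow]
    exact (Lp.memLp g).integrable_sq.mul_prod (Lp.memLp f).integrable_sq
  exact ⟨h.toLp, h.coeFn_toLp⟩

theorem inner_tensor [SFinite μ] {g f g' f' : Lp ℝ 2 μ} {F F' : Lp ℝ 2 (μ.prod μ)}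
    (hF : F =ᵐ[μ.prod μ] fun p => g p.1 * f p.2) (hF' : F' =ᵐ[μ.prod μ] fun p => g' p.1 * f' p.2) :
    (inner ℝ F F' : ℝ) = inner ℝ g g' * inner ℝ f f' := by
  simp only [L2.inner_def]
  rw [← integral_prod_mul]
  refine integral_congr_ae ?_
  filter_upwards [hF, hF'] with p hp hp'
  rw [hp, hp']
  simp
  ring

/-- Hilbert–Schmidt operators on `L²` are integral operators. -/
theorem exists_kernel [IsFiniteMeasure μ] (T : Lp ℝ 2 μ →L[ℝ] Lp ℝ 2 μ) {ι : Type*} (b : HilbertBasis ι ℝ (Lp ℝ 2 μ))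
    (hT : Summable fun i => ‖T (b i)‖ ^ 2) :
    ∃ K : Lp ℝ 2 (μ.prod μ), ∀ f : Lp ℝ 2 μ, T f =ᵐ[μ] fun x => ∫ ξ, K (x, ξ) * f ξ ∂μ := by
  choose F hF using fun i => exists_tensor (T (b i)) (b i)
  have horth : ∀ i j, i ≠ j → inner ℝ (F i) (F j) = 0 := fun i j hij => by
    rw [inner_tensor (hF i) (hF j), b.orthonormal.2 hij, mul_zero]
  have hnorm : ∀ i, ‖F i‖ ^ 2 = ‖T (b i)‖ ^ 2 := fun i => by
    rw [← real_inner_self_eq_norm_sq, inner_tensor (hF i) (hF i), real_inner_self_eq_norm_sq,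
      real_inner_self_eq_norm_sq, b.orthonormal.1, one_pow, mul_one]
  -- Lines are used in place of normalised vectors because some `F i` may vanish.
  have hfam : OrthogonalFamily ℝ (fun i => Submodule.span ℝ {F i})
      fun i => (Submodule.span ℝ {F i}).subtypeₗᵢ := by
    rintro i j hij ⟨v, hv⟩ ⟨w, hw⟩
    obtain ⟨a, rfl⟩ := Submodule.mem_span_singleton.1 hv
    obtain ⟨c, rfl⟩ := Submodule.mem_span_singleton.1 hw
    change inner ℝ (a • F i) (c • F j) = 0
    rw [real_inner_smul_left, real_inner_smul_right, horth i j hij, mul_zero, mul_zero]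
  have hsum : Summable F := by
    refine (hfam.summable_iff_norm_sq_summable
      fun i => ⟨F i, Submodule.mem_span_singleton_self _⟩).2 ?_
    change Summable fun i => ‖F i‖ ^ 2
    simpa only [hnorm] using hT
  refine ⟨∑' i, F i, fun f => ?_⟩
  set K := ∑' i, F i with hK
  -- Pairing K with g ⊗ f and expanding f in the basis recovers ⟨g, T f⟩; indicator functions g then
  -- identify T f through its set integrals.
  have hinner : ∀ (g : Lp ℝ 2 μ) (G : Lp ℝ 2 (μ.prod μ)),
      G =ᵐ[μ.prod μ] (fun p => g p.1 * f p.2) → inner ℝ G K = inner ℝ g (T f) := by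
    intro g G hG
    have h1 : HasSum (fun i => inner ℝ G (F i)) (inner ℝ G K) :=
      hsum.hasSum.mapL (innerSL ℝ G)
    have h2 : HasSum (fun i => inner ℝ g (T (b.repr f i • b i))) (inner ℝ g (T f)) :=
      ((b.hasSum_repr f).mapL T).mapL (innerSL ℝ g)
    refine h1.unique (h2.congr_fun ?_)
    intro i
    rw [inner_tensor hG (hF i), map_smul, inner_smul_right, b.repr_apply_apply, mul_comm,
      real_inner_comm]
  -- Pairing K with 1 ⊗ f, square integrable since μ is finite, makes K(x, ξ) f(ξ) integrable on the
  -- product.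
  obtain ⟨G₁, hG₁⟩ := exists_tensor (Lp.const 2 μ (1 : ℝ)) f
  have hint : Integrable (fun p : α × α => K p * f p.2) (μ.prod μ) := by
    refine (L2.integrable_inner (𝕜 := ℝ) G₁ K).congr ?_
    have hone : ∀ᵐ p ∂μ.prod μ, (Lp.const 2 μ (1 : ℝ)) p.1 = 1 :=
      Measure.quasiMeasurePreserving_fst.ae (Lp.coeFn_const 2 μ (1 : ℝ))
    filter_upwards [hG₁, hone] with p hp h1
    rw [hp, h1]
    simp
  refine Integrable.ae_eq_of_forall_setIntegral_eq _ _ ((Lp.memLp (T f)).integrable (by norm_num))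
    hint.integral_prod_left fun s hs _ => ?_
  obtain ⟨g, hg⟩ : ∃ g : Lp ℝ 2 μ, g =ᵐ[μ] s.indicator fun _ => (1 : ℝ) :=
    ⟨indicatorConstLp 2 hs (measure_ne_top μ s) 1, indicatorConstLp_coeFn⟩
  obtain ⟨G, hG⟩ := exists_tensor g f
  have h := hinner g G hG
  have hl : inner ℝ g (T f) = ∫ x in s, T f x ∂μ := by
    rw [L2.inner_def, ← integral_indicator hs]
    refine integral_congr_ae ?_
    filter_upwards [hg] with x hx
    rw [hx]
    by_cases hxs : x ∈ s <;> simp [hxs]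
  have hr : inner ℝ G K = ∫ x in s, ∫ ξ, K (x, ξ) * f ξ ∂μ ∂μ := by
    have hg' : ∀ᵐ p ∂μ.prod μ, g p.1 = s.indicator (fun _ => (1 : ℝ)) p.1 :=
      Measure.quasiMeasurePreserving_fst.ae hg
    have h1 : inner ℝ G K = ∫ p, (s ×ˢ (univ : Set α)).indicator (fun p => K p * f p.2) p
        ∂μ.prod μ := by
      rw [L2.inner_def]
      refine integral_congr_ae ?_
      filter_upwards [hG, hg'] with p hp hp'
      rw [hp, hp']
      by_cases hxs : p.1 ∈ s <;> simp [hxs, indicator]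
    rw [h1, integral_indicator (hs.prod MeasurableSet.univ),
      setIntegral_prod _ hint.integrableOn, Measure.restrict_univ]
  rw [← hl, ← hr, h]

end Kernel

/-! ### The Green's operator -/

theorem Collection.IsAdmissible.greenOperator_mem {C : Collection n} (hC : C.IsAdmissible)
    (f : L2 C.U) : C.greenOperator f ∈ C.domain :=
  Function.invFunOn_mem (hC.bijOn.surjOn (mem_univ f))

theorem Collection.IsAdmissible.toL2_greenOperator {C : Collection n} (hC : C.IsAdmissible)
    (f : L2 C.U) : C.A.toL2 C.U (C.greenOperator f) = f :=
  Function.invFunOn_eq (hC.bijOn.surjOn (mem_univ f))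

theorem Collection.IsAdmissible.isFiniteMeasure {C : Collection n} (hC : C.IsAdmissible) :
    IsFiniteMeasure (volume.restrict C.U) :=
  isFiniteMeasure_restrict.2 hC.isBounded.measure_lt_top.ne

theorem Collection.IsAdmissible.exists_ae_abs_greenOperator_le {C : Collection n}
    (hC : C.IsAdmissible) (hm : (n : ℝ) / 2 < C.A.order) (f : L2 C.U) :
    ∃ M : ℝ, ∀ᵐ x ∂volume.restrict C.U, |C.greenOperator f x| ≤ M :=
  (hC.greenOperator_mem f).1.exists_ae_abs_le hC.isOpen hC.isBounded hC.smoothBoundary hm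

theorem Collection.IsAdmissible.exists_isGreenFunction {C : Collection n} (hC : C.IsAdmissible)
    (hm : (n : ℝ) / 2 < C.A.order) : ∃ K : E n → E n → ℝ, C.IsGreenFunction K := by
  have := hC.isFiniteMeasure
  obtain ⟨T, -, hTg⟩ := hC.selfAdjoint
  obtain ⟨w, b, -⟩ := exists_hilbertBasis ℝ (L2 C.U)
  obtain ⟨K, hK⟩ := exists_kernel T b (summable_norm_sq_apply T (fun f => by
    simpa only [hTg] using hC.exists_ae_abs_greenOperator_le hm f) b.orthonormal)
  exact ⟨fun x ξ => K (x, ξ), Lp.memLp K, fun f => by simpa only [hTg] using hK f⟩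

theorem Collection.IsAdmissible.inner_greenOperator_nonneg {C : Collection n}
    (hC : C.IsAdmissible) (hpos : C.IsPositive) (hm : (n : ℝ) / 2 < C.A.order) (f : L2 C.U) :
    0 ≤ (inner ℝ (C.greenOperator f) f : ℝ) := by
  have := hC.isFiniteMeasure
  obtain ⟨T, hTs, hTg⟩ := hC.selfAdjoint
  obtain ⟨w, b, -⟩ := exists_hilbertBasis ℝ (L2 C.U)
  have hc : IsCompactOperator T := isCompactOperator_of_summable_norm_sq b T
    (summable_norm_sq_apply T (fun f => by
      simpa only [hTg] using hC.exists_ae_abs_greenOperator_le hm f) b.orthonormal)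
  rw [← hTg]
  exact inner_nonneg_of_eigenvalues_nonneg hc hTs.isSymmetric
    (fun c v hv h => (hpos c v hv (by rw [← hTg, h])).le) f

theorem Collection.IsGreenFunction.integrable {C : Collection n} (hC : C.IsAdmissible)
    {K : E n → E n → ℝ} (hK : C.IsGreenFunction K) :
    Integrable (Function.uncurry K) ((volume.restrict C.U).prod (volume.restrict C.U)) := by
  have := hC.isFiniteMeasure
  exact hK.memLp.integrable (by norm_num)

theorem Collection.IsGreenFunction.integral_eq {C : Collection n} {K : E n → E n → ℝ}
    (hK : C.IsGreenFunction K) {f : L2 C.U} (hf : f =ᵐ[volume.restrict C.U] fun _ => (1 : ℝ)) :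
    ∫ x in C.U, ∫ ξ in C.U, K x ξ = ∫ x in C.U, C.greenOperator f x := by
  refine integral_congr_ae ?_
  filter_upwards [hK.represents f] with x hx
  rw [hx]
  refine integral_congr_ae ?_
  filter_upwards [hf] with ξ hξ
  rw [hξ, mul_one]

theorem inner_eq_integral_of_ae_eq_one {U : Set (E n)} (u : L2 U) {f : L2 U}
    (hf : f =ᵐ[volume.restrict U] fun _ => (1 : ℝ)) : (inner ℝ u f : ℝ) = ∫ x in U, u x := by
  rw [L2.inner_def]
  refine integral_congr_ae ?_
  filter_upwards [hf] with x hx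
  rw [hx]
  simp

end BVP

end

/-! ### Sign of the mean of the Green's function -/

theorem corollary2p2 (n : ℕ) (hn : 0 < n) (C : BVP.Collection n) (hC : C.IsAdmissible)
    (hpos : C.IsPositive) (hm : (n : ℝ) / 2 < C.A.order) :
    (∃ K : BVP.E n → BVP.E n → ℝ, C.IsGreenFunction K) ∧
    (∀ K : BVP.E n → BVP.E n → ℝ, C.IsGreenFunction K →
      Integrable (Function.uncurry K) ((volume.restrict C.U).prod (volume.restrict C.U)) ∧
      0 ≤ ∫ x in C.U, ∫ ξ in C.U, K x ξ) ∧
    (∃ u ∈ C.domain, C.A.toL2 C.U u =ᵐ[volume.restrict C.U] (fun _ => (1 : ℝ)) ∧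
      (∀ w ∈ C.domain, C.A.toL2 C.U w =ᵐ[volume.restrict C.U] (fun _ => (1 : ℝ)) → w = u) ∧
      0 ≤ ⨍ x in C.U, u x ∧
      ∀ K : BVP.E n → BVP.E n → ℝ, C.IsGreenFunction K →
        ∫ x in C.U, ∫ ξ in C.U, K x ξ = ∫ x in C.U, u x) := by
  have := hC.isFiniteMeasure
  obtain ⟨f, hf⟩ : ∃ f : BVP.L2 C.U, f =ᵐ[volume.restrict C.U] fun _ => (1 : ℝ) :=
    ⟨Lp.const 2 _ 1, Lp.coeFn_const 2 _ 1⟩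
  -- The integral is the quadratic form of A⁻¹ at the constant function 1.
  have h0 : 0 ≤ ∫ x in C.U, C.greenOperator f x := by
    rw [← BVP.inner_eq_integral_of_ae_eq_one _ hf]
    exact hC.inner_greenOperator_nonneg hpos hm f
  refine ⟨hC.exists_isGreenFunction hm, fun K hK => ⟨hK.integrable hC, ?_⟩,
    C.greenOperator f, hC.greenOperator_mem f, ?_, fun w hw hAw => ?_, ?_,
    fun K hK => hK.integral_eq hf⟩
  · rw [hK.integral_eq hf]
    exact h0
  · rw [hC.toL2_greenOperator f]
    exact hf
  · refine hC.bijOn.injOn hw (hC.greenOperator_mem f) ?_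
    rw [hC.toL2_greenOperator f]
    exact Lp.ext (hAw.trans hf.symm)
  · rw [setAverage_eq]
    exact smul_nonneg (inv_nonneg.2 measureReal_nonneg) h0
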